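/- Let $n\ge 2$. Let $\mathcal N$ be the space of real symmetric $n\times n$ matrices of trace zero, on which $SO_n$ acts by $g\cdot A=gAg^T$, and let $\mathbb R[\mathcal N]$ be the algebra of real polynomial functions on $\mathcal N$, with the action $(g\cdot f)(A)=f(g^{-1}\cdot A)$. Let $\mathcal F\subset\mathcal N$ be the set of degenerate matrices in $\mathcal N$, i.e. those with a multiple eigenvalue, and let $\mathcal I(\mathcal F)\subset\mathbb R[\mathcal N]$ be the ideal of polynomial functions vanishing on $\mathcal F$. Then the degree $n(n-1)/2$ homogeneous component of $\mathcal I(\mathcal F)$ contains an $SO_n$-submodule isomorphic to $\mathcal H^n(\mathbb R^n)$, the space of spherical harmonics of degree $n$ in $n$ variables, i.e. of polynomials $p\in\mathbb R[x_1,\dots,x_n]$ that are homogeneous of degree $n$ and satisfy $\sum_{i=1}^n\partial^2p/\partial x_i^2=0$, with the action $(g\cdot p)(x)=p(g^{-1}x)$. Consequently, the discriminant of $n\times n$ real symmetric matrices, i.e. the polynomial function $\delta(A)=\prod_{i<j}(\lambda_i-\lambda_j)^2$, where $\lambda_1,\dots,\lambda_n$ are the eigenvalues of $A$ with multiplicity,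 can be written as a sum of $\binom{2n-1}{n-1}-\binom{2n-3}{n-1}$ squares of real polynomial functions on the space of real symmetric $n\times n$ matrices. -/

import Mathlib

namespace SymDisc

section PolynomialFunctions

/-- The algebra `ℝ[V]` of real-valued polynomial functions on the real vector space `V`:
the algebra of functions generated by the linear forms. -/
def PolyFun (V : Type*) [AddCommGroup V] [Module ℝ V] : Subalgebra ℝ (V → ℝ) :=
  Algebra.adjoin ℝ (Set.range fun (l : V →ₗ[ℝ] ℝ) (v : V) => l v)

variable {V : Type*} [AddCommGroup V] [Module ℝ V]

/-- The space of homogeneous polynomial functions of degree `d` on `V`. -/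
def homogeneousPart (V : Type*) [AddCommGroup V] [Module ℝ V] (d : ℕ) :
    Submodule ℝ (PolyFun V) where
  carrier := {f | ∀ (c : ℝ) (v : V), (f : V → ℝ) (c • v) = c ^ d * (f : V → ℝ) v}
  add_mem' {f g} hf hg c v := by
    change (f : V → ℝ) (c • v) + (g : V → ℝ) (c • v) =
      c ^ d * ((f : V → ℝ) v + (g : V → ℝ) v)
    rw [hf c v, hg c v, mul_add]
  zero_mem' c v := by
    change (0 : ℝ) = c ^ d * 0
    rw [mul_zero]
  smul_mem' r f hf c v := by
    change r * (f : V → ℝ) (c • v) = c ^ d * (r * (f : V → ℝ) v)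
    rw [hf c v]
    ring

/-- The ideal of the polynomial functions on `V` that vanish on the subset `S`. -/
def vanishingIdeal (S : Set V) : Ideal (PolyFun V) where
  carrier := {f | ∀ v ∈ S, (f : V → ℝ) v = 0}
  add_mem' {f g} hf hg v hv := by
    change (f : V → ℝ) v + (g : V → ℝ) v = 0
    rw [hf v hv, hg v hv, add_zero]
  zero_mem' _ _ := rfl
  smul_mem' h f hf v hv := by
    change (h : V → ℝ) v * (f : V → ℝ) v = 0
    rw [hf v hv, mul_zero]

/-- The degree `d` homogeneous component of the vanishing ideal of `S`. -/
def vanishingIdealPart (S : Set V) (d : ℕ) : Submodule ℝ (PolyFun V) :=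
  (vanishingIdeal S).restrictScalars ℝ ⊓ homogeneousPart V d

theorem polyFun_comp_mem (L : V →ₗ[ℝ] V) {f : V → ℝ} (hf : f ∈ PolyFun V) :
    (fun v => f (L v)) ∈ PolyFun V := by
  induction hf using Algebra.adjoin_induction with
  | mem x hx =>
    obtain ⟨l, rfl⟩ := hx
    exact Algebra.subset_adjoin ⟨l.comp L, rfl⟩
  | algebraMap r => exact (PolyFun V).algebraMap_mem r
  | add x y _ _ hx hy => exact (PolyFun V).add_mem hx hy
  | mul x y _ _ hx hy => exact (PolyFun V).mul_mem hx hy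

/-- The representation of `G` on `ℝ[V]` induced by a representation of `G` on `V`:
`(g · f) v = f (g⁻¹ v)`. -/
def coordRep {G : Type*} [Group G] (ρ : Representation ℝ G V) :
    Representation ℝ G (PolyFun V) where
  toFun g :=
    { toFun := fun f => ⟨fun v => (f : V → ℝ) (ρ g⁻¹ v), polyFun_comp_mem (ρ g⁻¹) f.2⟩
      map_add' := fun _ _ => rfl
      map_smul' := fun _ _ => rfl }
  map_one' := by
    ext f v
    simp
  map_mul' g h := by
    ext f v
    simp

end PolynomialFunctions

/-- The special orthogonal group `SO_n`. -/
abbrev SO (n : ℕ) : Submonoid (Matrix (Fin n) (Fin n) ℝ) :=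
  Matrix.specialOrthogonalGroup (Fin n) ℝ

theorem SO.mul_transpose {n : ℕ} (g : SO n) :
    (g : Matrix (Fin n) (Fin n) ℝ) * (g : Matrix (Fin n) (Fin n) ℝ).transpose = 1 :=
  (Matrix.mem_orthogonalGroup_iff (Fin n) ℝ).1 (Matrix.mem_specialOrthogonalGroup_iff.1 g.2).1

theorem SO.transpose_mul {n : ℕ} (g : SO n) :
    (g : Matrix (Fin n) (Fin n) ℝ).transpose * (g : Matrix (Fin n) (Fin n) ℝ) = 1 :=
  (Matrix.mem_orthogonalGroup_iff' (Fin n) ℝ).1 (Matrix.mem_specialOrthogonalGroup_iff.1 g.2).1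

section SymmetricMatrices

/-- The space of real symmetric `n × n` matrices. -/
def SymMat (n : ℕ) : Submodule ℝ (Matrix (Fin n) (Fin n) ℝ) where
  carrier := {A | A.IsSymm}
  add_mem' hA hB := hA.add hB
  zero_mem' := Matrix.isSymm_zero
  smul_mem' c _ hA := hA.smul c

/-- The space of trace zero real symmetric `n × n` matrices. -/
def SymMat₀ (n : ℕ) : Submodule ℝ (Matrix (Fin n) (Fin n) ℝ) :=
  SymMat n ⊓ LinearMap.ker (Matrix.traceLinearMap (Fin n) ℝ ℝ)

/-- A real symmetric matrix is degenerate if it has a multiple eigenvalue, i.e. if its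
characteristic polynomial (all of whose roots are real) has a multiple root. -/
def IsDegenerate {n : ℕ} (A : Matrix (Fin n) (Fin n) ℝ) : Prop :=
  ∃ μ : ℝ, 2 ≤ A.charpoly.rootMultiplicity μ

/-- The set of degenerate trace zero real symmetric `n × n` matrices. -/
def degenerateSet (n : ℕ) : Set (SymMat₀ n) :=
  {A | IsDegenerate (A : Matrix (Fin n) (Fin n) ℝ)}

theorem conj_mem {n : ℕ} (g : SO n) {A : Matrix (Fin n) (Fin n) ℝ} (hA : A ∈ SymMat₀ n) :
    (g : Matrix (Fin n) (Fin n) ℝ) * A * (g : Matrix (Fin n) (Fin n) ℝ).transpose ∈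
      SymMat₀ n := by
  obtain ⟨hs, ht⟩ := hA
  have hs' : A.transpose = A := hs
  have ht' : A.trace = 0 := ht
  refine ⟨?_, ?_⟩
  · change Matrix.transpose ((g : Matrix (Fin n) (Fin n) ℝ) * A *
      (g : Matrix (Fin n) (Fin n) ℝ).transpose) = _
    simp only [Matrix.transpose_mul, Matrix.transpose_transpose, hs', Matrix.mul_assoc]
  · change Matrix.trace ((g : Matrix (Fin n) (Fin n) ℝ) * A *
      (g : Matrix (Fin n) (Fin n) ℝ).transpose) = 0
    rw [Matrix.trace_mul_comm, ← Matrix.mul_assoc, SO.transpose_mul, Matrix.one_mul, ht']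

/-- The action of `SO_n` on trace zero symmetric matrices by conjugation, `g · A = g A gᵀ`. -/
def conjRep (n : ℕ) : Representation ℝ (SO n) (SymMat₀ n) where
  toFun g :=
    { toFun := fun A =>
        ⟨(g : Matrix (Fin n) (Fin n) ℝ) * A * (g : Matrix (Fin n) (Fin n) ℝ).transpose,
          conj_mem g A.2⟩
      map_add' := fun A B => Subtype.ext (by simp [Matrix.mul_add, Matrix.add_mul])
      map_smul' := fun c A => Subtype.ext (by simp) }
  map_one' := by
    refine LinearMap.ext fun A => Subtype.ext ?_
    simp
  map_mul' g h := by
    refine LinearMap.ext fun A => Subtype.ext ?_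
    simp [Matrix.transpose_mul, Matrix.mul_assoc]

end SymmetricMatrices

section SphericalHarmonics

open MvPolynomial

/-- The Laplace operator `∑ i, ∂²/∂xᵢ²` on `ℝ[x₁, …, xₙ]`. -/
noncomputable def laplacian (n : ℕ) :
    MvPolynomial (Fin n) ℝ →ₗ[ℝ] MvPolynomial (Fin n) ℝ :=
  ∑ i, (pderiv i).toLinearMap ∘ₗ (pderiv i).toLinearMap

/-- The linear substitution `p(x) ↦ p(M x)` on `ℝ[x₁, …, xₙ]`. -/
noncomputable def substMatrix {n : ℕ} (M : Matrix (Fin n) (Fin n) ℝ) :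
    MvPolynomial (Fin n) ℝ →ₐ[ℝ] MvPolynomial (Fin n) ℝ :=
  aeval fun i => ∑ j, C (M i j) * X j

theorem substMatrix_one (n : ℕ) : substMatrix (1 : Matrix (Fin n) (Fin n) ℝ) = AlgHom.id ℝ _ := by
  refine MvPolynomial.algHom_ext fun i => ?_
  simp [substMatrix, Matrix.one_apply]

theorem substMatrix_mul {n : ℕ} (M N : Matrix (Fin n) (Fin n) ℝ) :
    substMatrix (M * N) = (substMatrix N).comp (substMatrix M) := by
  refine MvPolynomial.algHom_ext fun i => ?_
  simp only [substMatrix, aeval_X, AlgHom.comp_apply, map_sum, map_mul, algHom_C,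
    Matrix.mul_apply, Finset.sum_mul, Finset.mul_sum]
  rw [Finset.sum_comm]
  refine Finset.sum_congr rfl fun j _ => Finset.sum_congr rfl fun k _ => ?_
  simp [mul_assoc, MvPolynomial.algebraMap_eq]

/-- The action of `SO_n` on `ℝ[x₁, …, xₙ]`, `(g · p)(x) = p(g⁻¹ x)`. -/
noncomputable def substRep (n : ℕ) : Representation ℝ (SO n) (MvPolynomial (Fin n) ℝ) where
  toFun g := (substMatrix ((g⁻¹ : SO n) : Matrix (Fin n) (Fin n) ℝ)).toLinearMap
  map_one' := by
    refine LinearMap.ext fun p => ?_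
    simp [substMatrix_one]
  map_mul' g h := by
    refine LinearMap.ext fun p => ?_
    simp [substMatrix_mul]

/-- The space of harmonic homogeneous polynomials of degree `d` in `n` variables. -/
noncomputable def harmonicSpace (d n : ℕ) : Submodule ℝ (MvPolynomial (Fin n) ℝ) :=
  homogeneousSubmodule (Fin n) ℝ d ⊓ LinearMap.ker (laplacian n)

theorem pderiv_substMatrix {n : ℕ} (M : Matrix (Fin n) (Fin n) ℝ) (k : Fin n)
    (p : MvPolynomial (Fin n) ℝ) :
    pderiv k (substMatrix M p) = ∑ i, C (M i k) * substMatrix M (pderiv i p) := by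
  induction p using MvPolynomial.induction_on with
  | C a => simp [substMatrix]
  | add p q hp hq => simp [hp, hq, mul_add, Finset.sum_add_distrib]
  | mul_X p m hp =>
    have hX : pderiv k (substMatrix M (X m)) = C (M m k) := by
      simp [substMatrix, pderiv_X, Pi.single_apply]
    rw [map_mul, Derivation.leibniz, hp, hX]
    simp only [Derivation.leibniz, smul_eq_mul, map_add, map_mul, mul_add,
      Finset.sum_add_distrib, pderiv_X, Pi.single_apply, Finset.mul_sum]
    congr 1
    · rw [Finset.sum_eq_single m]
      · simp [mul_comm]
      · intro b _ hb
        simp [hb.symm]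
      · simp
    · refine Finset.sum_congr rfl fun i _ => ?_
      ring

theorem laplacian_substMatrix {n : ℕ} {M : Matrix (Fin n) (Fin n) ℝ} (hM : M * M.transpose = 1)
    (p : MvPolynomial (Fin n) ℝ) :
    laplacian n (substMatrix M p) = substMatrix M (laplacian n p) := by
  have key : ∀ i j, ∑ k, C (M i k) * C (M j k) =
      (C ((1 : Matrix (Fin n) (Fin n) ℝ) i j) : MvPolynomial (Fin n) ℝ) := by
    intro i j
    rw [← hM, Matrix.mul_apply, map_sum]
    simp
  have h1 : laplacian n (substMatrix M p) =
      ∑ i, ∑ j, (∑ k, C (M i k) * C (M j k)) * substMatrix M (pderiv j (pderiv i p)) := by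
    simp only [laplacian, LinearMap.sum_apply, LinearMap.comp_apply,
      Derivation.coeFn_coe, pderiv_substMatrix, map_sum, Derivation.leibniz,
      pderiv_C, smul_eq_mul, mul_zero, add_zero, Finset.mul_sum, Finset.sum_mul]
    rw [Finset.sum_comm]
    refine Finset.sum_congr rfl fun i _ => ?_
    rw [Finset.sum_comm]
    refine Finset.sum_congr rfl fun j _ => Finset.sum_congr rfl fun k _ => ?_
    ring
  rw [h1]
  simp [key, Matrix.one_apply, laplacian]

theorem substMatrix_mem {d n : ℕ} (M : Matrix (Fin n) (Fin n) ℝ)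
    (hM : M * M.transpose = 1) {p : MvPolynomial (Fin n) ℝ} (hp : p ∈ harmonicSpace d n) :
    substMatrix M p ∈ harmonicSpace d n := by
  obtain ⟨h1, h2⟩ := hp
  refine ⟨?_, ?_⟩
  · have h1' : p.IsHomogeneous d := h1
    have := h1'.aeval (n := 1) (fun i => ∑ j, C (M i j) * X j) (fun i =>
      IsHomogeneous.sum _ _ _ fun j _ => by
        simpa using (isHomogeneous_C (Fin n) (M i j)).mul (isHomogeneous_X ℝ j))
    rw [one_mul] at this
    exact this
  · have h2' : laplacian n p = 0 := h2
    change laplacian n _ = 0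
    rw [laplacian_substMatrix hM, h2', map_zero]

/-- The space `ℋ^d(ℝⁿ)` of `n`-variable spherical harmonics of degree `d`, as an
`SO_n`-submodule of `ℝ[x₁, …, xₙ]`. -/
noncomputable def sphericalHarmonics (d n : ℕ) : Subrepresentation (substRep n) where
  toSubmodule := harmonicSpace d n
  apply_mem_toSubmodule g _ hp := substMatrix_mem _ (SO.mul_transpose g⁻¹) hp

end SphericalHarmonics

end SymDisc

/-!
The construction rests on the Krylov determinant `K_A(x) = det (x, A x, …, Aⁿ⁻¹ x)`, a form of
degree `n` in `x` whose coefficients are forms of degree `n (n - 1) / 2` in the entries of `A`.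
For orthogonal `M` it satisfies `K_A(M x) = det M · K_{Mᵀ A M}(x)` (`substMatrix_krylovDet`), and
for a diagonal matrix it is the Vandermonde determinant of the diagonal entries times `x₁ ⋯ xₙ`
(`krylovDet_diagonal`). By the spectral theorem, for symmetric `A` it is therefore, up to sign, the
Vandermonde determinant of the eigenvalues times an orthogonal image of `x₁ ⋯ xₙ`
(`exists_krylovDet_eq`). As `x₁ ⋯ xₙ` is harmonic, `K_A` lies in `ℋⁿ(ℝⁿ)`; it vanishes when `A` is
degenerate; and since the Fischer inner product `⟨p, q⟩ = (p(∂) q)(0)` is orthogonally invariant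
with `⟨x₁ ⋯ xₙ, x₁ ⋯ xₙ⟩ = 1`, the discriminant of `A` is `⟨K_A, K_A⟩`.

The map sending `p ∈ ℋⁿ(ℝⁿ)` to the function `A ↦ ⟨p, K_A⟩` is thus an equivariant map into the
degree `n (n - 1) / 2` part of the vanishing ideal. It is injective because the orthogonal images
of `x₁ ⋯ xₙ` span `ℋⁿ(ℝⁿ)` (`eq_zero_of_fischer_substMatrix_prod_X`). For this, let `h` be harmonic
and orthogonal to all these images. The forms whose whole orthogonal orbit is orthogonal to `h` make
up a space that is stable under the infinitesimal rotations `x_b ∂_a - x_a ∂_b` and contains both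
`x₁ ⋯ xₙ` and the multiples of `∑ xᵢ²`. A purely algebraic induction
(`homogeneous_mem_of_infRot_stable`) shows that such a space contains every form of degree `n`,
in particular `h` itself, so that `⟨h, h⟩ = 0`.

Expanding `⟨K_A, K_A⟩` in a Fischer orthonormal basis of `ℋⁿ(ℝⁿ)` writes the discriminant as a sum
of `dim ℋⁿ(ℝⁿ)` squares. The bound on this dimension holds because `ℋⁿ(ℝⁿ)` is orthogonal to the
multiples of `∑ xᵢ²`: the Laplace operator is adjoint to multiplication by `∑ xᵢ²`.
-/

namespace SymDisc

/-! ### The discriminant of a polynomial with given roots -/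

open Polynomial in
/-- The discriminant of a split monic polynomial in terms of its roots. -/
theorem discr_prod_X_sub_C {n : ℕ} (hn : 0 < n) (v : Fin n → ℝ) :
    (∏ i, (X - C (v i))).discr = (Matrix.vandermonde v).det ^ 2 := by
  set f : ℝ[X] := ∏ i, (X - C (v i)) with hf
  have hmonic : f.Monic := monic_prod_of_monic _ _ fun i _ => monic_X_sub_C _
  have hdeg : f.natDegree = n := by
    rw [hf, natDegree_prod_of_monic _ _ fun i _ => monic_X_sub_C _]
    simp
  have h1 := resultant_deriv (f := f) (natDegree_pos_iff_degree_pos.1 (by omega))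
  rw [hf, resultant_prod_left _ _ _ _ (by simp) (natDegree_derivative_le _), ← hf, hdeg,
    hmonic.leadingCoeff, mul_one] at h1
  have h2 : ∀ i, (X - C (v i)).resultant (derivative f) (X - C (v i)).natDegree (n - 1) =
      ∏ j ∈ Finset.univ.erase i, (v i - v j) := by
    intro i
    rw [natDegree_X_sub_C, resultant_X_sub_C_left _ _ _ (hdeg ▸ natDegree_derivative_le f), hf,
      derivative_prod_finset, eval_finsetSum, Finset.sum_eq_single i]
    · simp [eval_prod]
    · intro j _ hj
      rw [eval_mul, eval_prod,
        Finset.prod_eq_zero (Finset.mem_erase.2 ⟨hj.symm, Finset.mem_univ i⟩)]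
      · simp
      · simp
    · simp
  simp only [h2] at h1
  -- Each pair `i < j` contributes `v i - v j` and `v j - v i`; the sign counts the pairs.
  have h3 : ∏ i, ∏ j ∈ Finset.univ.erase i, (v i - v j) =
      (-1) ^ (n * (n - 1) / 2) * (Matrix.vandermonde v).det ^ 2 := by
    have hsplit : ∀ i : Fin n, ∏ j ∈ Finset.univ.erase i, (v i - v j) =
        (∏ j ∈ Finset.Iio i, (v i - v j)) *
          ((-1) ^ (Finset.Ioi i).card * ∏ j ∈ Finset.Ioi i, (v j - v i)) := by
      intro i
      rw [← Finset.prod_const, ← Finset.prod_mul_distrib,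
        ← Finset.prod_congr (rfl : Finset.Ioi i = _) (fun j _ => show v i - v j = _ by ring),
        ← Finset.prod_union]
      · congr 1
        ext j
        simp [lt_or_lt_iff_ne]
      · exact Finset.disjoint_left.2 fun j hj hj' =>
          lt_asymm (Finset.mem_Iio.1 hj) (Finset.mem_Ioi.1 hj')
    have hswap : ∏ i, ∏ j ∈ Finset.Iio i, (v i - v j) = (Matrix.vandermonde v).det := by
      rw [Matrix.det_vandermonde]
      exact Finset.prod_comm' (by simp)
    have hcard : ∑ i : Fin n, (Finset.Ioi i).card = n * (n - 1) / 2 := by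
      rw [← Finset.sum_range_id, ← Finset.sum_range_reflect, Finset.sum_range]
      simp
    simp only [hsplit, Finset.prod_mul_distrib]
    rw [hswap, ← Matrix.det_vandermonde, Finset.prod_pow_eq_pow_sum, hcard]
    ring
  rw [h3] at h1
  exact (mul_left_cancel₀ (by simp) h1).symm

open MvPolynomial

/-! ### The Fischer inner product -/

section Fischer

variable {σ : Type*} [Fintype σ]

/-- The weight `∏ i, (m i)!` of the exponent vector `m`: the squared norm of the monomial `x ^ m`
for the Fischer inner product. -/
def expWeight (m : σ →₀ ℕ) : ℝ := ∏ i, ((m i).factorial : ℝ)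

theorem expWeight_pos (m : σ →₀ ℕ) : 0 < expWeight m :=
  Finset.prod_pos fun i _ => by exact_mod_cast (m i).factorial_pos

theorem expWeight_add_single (m : σ →₀ ℕ) (i : σ) :
    expWeight (m + Finsupp.single i 1) = (m i + 1) * expWeight m := by
  classical
  unfold expWeight
  rw [← Finset.mul_prod_erase _ _ (Finset.mem_univ i),
    ← Finset.mul_prod_erase _ (fun i => ((m i).factorial : ℝ)) (Finset.mem_univ i), ← mul_assoc]
  congr 1
  · simp [Nat.factorial_succ]
  · refine Finset.prod_congr rfl fun j hj => ?_
    simp [(Finset.ne_of_mem_erase hj).symm]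

/-- The Fischer inner product on `ℝ[x₁, …, xₙ]`, `⟨p, q⟩ = (p(∂) q)(0)`. Monomials are pairwise
orthogonal, and `⟨x ^ m, x ^ m⟩ = ∏ i, (m i)!`. -/
noncomputable def fischer : MvPolynomial σ ℝ →ₗ[ℝ] MvPolynomial σ ℝ →ₗ[ℝ] ℝ :=
  (basisMonomials σ ℝ).constr ℝ fun m => expWeight m • lcoeff ℝ m

theorem fischer_monomial (m : σ →₀ ℕ) (c : ℝ) (q : MvPolynomial σ ℝ) :
    fischer (monomial m c) q = c * (expWeight m * coeff m q) := by
  have h : (monomial m c : MvPolynomial σ ℝ) = c • basisMonomials σ ℝ m := by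
    simp [smul_monomial]
  rw [h, map_smul, fischer, Module.Basis.constr_basis]
  simp

theorem fischer_eq_sum (p q : MvPolynomial σ ℝ) :
    fischer p q = ∑ m ∈ p.support, expWeight m * (coeff m p * coeff m q) := by
  conv_lhs => rw [p.as_sum, map_sum, LinearMap.sum_apply]
  refine Finset.sum_congr rfl fun m _ => ?_
  rw [fischer_monomial]
  ring

theorem fischer_comm (p q : MvPolynomial σ ℝ) : fischer p q = fischer q p := by
  classical
  induction p using MvPolynomial.induction_on' with
  | add p p' hp hp' => simp [hp, hp']
  | monomial m c =>
    induction q using MvPolynomial.induction_on' with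
    | add q q' hq hq' => simp [hq, hq']
    | monomial l d =>
      rw [fischer_monomial, fischer_monomial, coeff_monomial, coeff_monomial]
      rcases eq_or_ne l m with rfl | h
      · simp only [if_true]
        ring
      · simp [h, h.symm]

theorem eq_zero_of_fischer_self_eq_zero {p : MvPolynomial σ ℝ} (h : fischer p p = 0) : p = 0 := by
  rw [fischer_eq_sum, Finset.sum_eq_zero_iff_of_nonneg fun m _ =>
    mul_nonneg (expWeight_pos m).le (mul_self_nonneg _)] at h
  ext m
  by_contra hm
  have := h m (mem_support_iff.2 hm)
  exact hm (by simpa [(expWeight_pos m).ne'] using this)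

/-- Multiplication by a variable is adjoint to the partial derivative. -/
theorem fischer_X_mul (i : σ) (p q : MvPolynomial σ ℝ) :
    fischer (X i * p) q = fischer p (pderiv i q) := by
  induction p using MvPolynomial.induction_on' with
  | add p p' hp hp' => simp [mul_add, hp, hp']
  | monomial m c =>
    rw [X, monomial_mul, one_mul, add_comm, fischer_monomial, fischer_monomial,
      expWeight_add_single, coeff_pderiv]
    ring

theorem fischer_C (a : ℝ) (q : MvPolynomial σ ℝ) :
    fischer (C a) q = a * constantCoeff q := by
  rw [C_apply, fischer_monomial]
  simp [expWeight, constantCoeff_eq]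

theorem fischer_prod_X : fischer (∏ i, X i : MvPolynomial σ ℝ) (∏ i, X i) = 1 := by
  have h : (∏ i, X i : MvPolynomial σ ℝ) = monomial (Finsupp.equivFunOnFinite.symm 1) 1 := by
    rw [monomial_eq, Finsupp.prod_fintype _ _ (by simp)]
    simp
  classical
  rw [h, fischer_monomial, coeff_monomial, if_pos rfl]
  simp [expWeight]

end Fischer

variable {n : ℕ}

theorem constantCoeff_substMatrix (M : Matrix (Fin n) (Fin n) ℝ) (q : MvPolynomial (Fin n) ℝ) :
    constantCoeff (substMatrix M q) = constantCoeff q := by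
  induction q using MvPolynomial.induction_on with
  | C a => simp [substMatrix]
  | add p q hp hq => simp [hp, hq]
  | mul_X p i _ => simp [substMatrix]

/-- The Fischer inner product is invariant under orthogonal substitutions. -/
theorem fischer_substMatrix {M : Matrix (Fin n) (Fin n) ℝ} (hM : M * M.transpose = 1)
    (p q : MvPolynomial (Fin n) ℝ) :
    fischer (substMatrix M p) (substMatrix M q) = fischer p q := by
  induction p using MvPolynomial.induction_on generalizing q with
  | C a =>
    have : substMatrix M (C a) = C a := by simp [substMatrix]
    rw [this, fischer_C, fischer_C, constantCoeff_substMatrix]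
  | add p p' hp hp' => simp [hp, hp']
  | mul_X p i hp =>
    have hX : substMatrix M (p * X i) = ∑ j, M i j • (X j * substMatrix M p) := by
      simp only [map_mul, substMatrix, aeval_X, Finset.mul_sum, smul_eq_C_mul]
      exact Finset.sum_congr rfl fun j _ => by ring
    have key : ∀ k, ∑ j, M i j * M k j = (1 : Matrix (Fin n) (Fin n) ℝ) i k := fun k => by
      rw [← hM, Matrix.mul_apply]
      rfl
    calc fischer (substMatrix M (p * X i)) (substMatrix M q)
        = ∑ j, ∑ k, M i j * M k j * fischer p (pderiv k q) := by
          rw [hX, map_sum, LinearMap.sum_apply]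
          refine Finset.sum_congr rfl fun j _ => ?_
          rw [map_smul, LinearMap.smul_apply, fischer_X_mul, pderiv_substMatrix, map_sum,
            smul_eq_mul, Finset.mul_sum]
          refine Finset.sum_congr rfl fun k _ => ?_
          rw [← smul_eq_C_mul, map_smul, hp, smul_eq_mul, mul_assoc]
      _ = ∑ k, (1 : Matrix (Fin n) (Fin n) ℝ) i k * fischer p (pderiv k q) := by
          rw [Finset.sum_comm]
          simp only [← Finset.sum_mul, key]
      _ = fischer (p * X i) q := by
          simp [Matrix.one_apply, mul_comm p, fischer_X_mul]

/-- The squared radius `∑ i, xᵢ²`. -/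
noncomputable def radiusSq (n : ℕ) : MvPolynomial (Fin n) ℝ := ∑ i, X i ^ 2

/-- Multiplication by `∑ i, xᵢ²` is adjoint to the Laplace operator. -/
theorem fischer_radiusSq_mul (p q : MvPolynomial (Fin n) ℝ) :
    fischer (radiusSq n * p) q = fischer p (laplacian n q) := by
  simp only [radiusSq, Finset.sum_mul, map_sum, LinearMap.sum_apply, laplacian, pow_two,
    mul_assoc, fischer_X_mul]
  rfl

theorem substMatrix_radiusSq {M : Matrix (Fin n) (Fin n) ℝ} (hM : M.transpose * M = 1) :
    substMatrix M (radiusSq n) = radiusSq n := by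
  have key : ∀ j k, ∑ i, (C (M i j) * C (M i k) : MvPolynomial (Fin n) ℝ) =
      C ((1 : Matrix (Fin n) (Fin n) ℝ) j k) := fun j k => by
    rw [← hM, Matrix.mul_apply, map_sum]
    simp
  have hX : ∀ i, substMatrix M (X i) = ∑ j, C (M i j) * X j := fun i => by simp [substMatrix]
  calc substMatrix M (radiusSq n)
      = ∑ j, ∑ k, (∑ i, C (M i j) * C (M i k)) * (X j * X k) := by
        simp only [radiusSq, map_sum, pow_two, map_mul, hX, Finset.sum_mul, Finset.mul_sum]
        rw [Finset.sum_comm]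
        refine Finset.sum_congr rfl fun j _ => ?_
        rw [Finset.sum_comm]
        refine Finset.sum_congr rfl fun k _ => Finset.sum_congr rfl fun i _ => ?_
        ring
    _ = radiusSq n := by
        simp [key, Matrix.one_apply, radiusSq, pow_two]

/-! ### Spaces of forms stable under infinitesimal rotations -/

section RotationStable

variable {n : ℕ}

/-- The infinitesimal rotation `x_b ∂_a - x_a ∂_b` in the coordinate plane of `a` and `b`. -/
noncomputable def infRot (a b : Fin n) :
    Derivation ℝ (MvPolynomial (Fin n) ℝ) (MvPolynomial (Fin n) ℝ) :=
  (X b : MvPolynomial (Fin n) ℝ) • pderiv a - (X a : MvPolynomial (Fin n) ℝ) • pderiv b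

theorem infRot_apply (a b : Fin n) (p : MvPolynomial (Fin n) ℝ) :
    infRot a b p = X b * pderiv a p - X a * pderiv b p := rfl

theorem infRot_X_left {a b : Fin n} (h : a ≠ b) : infRot a b (X a) = X b := by
  simp [infRot_apply, pderiv_X_of_ne h]

theorem infRot_X_right {a b : Fin n} (h : a ≠ b) : infRot a b (X b) = -X a := by
  simp [infRot_apply, pderiv_X_of_ne h.symm]

theorem infRot_X_of_ne {a b c : Fin n} (ha : c ≠ a) (hb : c ≠ b) : infRot a b (X c) = 0 := by
  simp [infRot_apply, pderiv_X_of_ne ha, pderiv_X_of_ne hb]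

theorem infRot_prod_X {a b : Fin n} {S : Finset (Fin n)} (ha : a ∉ S) (hb : b ∉ S) :
    infRot a b (∏ i ∈ S, X i) = 0 := by
  classical
  induction S using Finset.induction_on with
  | empty => simp
  | insert c S hc ih =>
    simp only [Finset.mem_insert, not_or] at ha hb
    rw [Finset.prod_insert hc, Derivation.leibniz, ih ha.2 hb.2,
      infRot_X_of_ne (Ne.symm ha.1) (Ne.symm hb.1)]
    simp

theorem natCast_mul_mem {W : Submodule ℝ (MvPolynomial (Fin n) ℝ)} (k : ℕ)
    {p : MvPolynomial (Fin n) ℝ} (hp : p ∈ W) : (k : MvPolynomial (Fin n) ℝ) * p ∈ W := by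
  rw [← nsmul_eq_mul]
  exact W.nsmul_mem hp k

theorem mem_of_natCast_mul_mem {W : Submodule ℝ (MvPolynomial (Fin n) ℝ)} {k : ℕ} (hk : k ≠ 0)
    {p : MvPolynomial (Fin n) ℝ} (hp : (k : MvPolynomial (Fin n) ℝ) * p ∈ W) : p ∈ W := by
  have hk' : (k : ℝ) ≠ 0 := by exact_mod_cast hk
  rw [← nsmul_eq_mul, ← Nat.cast_smul_eq_nsmul ℝ] at hp
  exact (W.smul_mem_iff hk').1 hp

variable {W : Submodule ℝ (MvPolynomial (Fin n) ℝ)}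

/-- One inductive step towards pure powers: the exponent of `x_i` is raised by trading it against
a variable of the squarefree factor, modulo multiples of `∑ i, xᵢ²`. -/
theorem X_pow_succ_mul_prod_mem (hD : ∀ a b, a ≠ b → ∀ q ∈ W, infRot a b q ∈ W)
    (hr : ∀ q : MvPolynomial (Fin n) ℝ, q.IsHomogeneous (n - 2) → radiusSq n * q ∈ W) {m : ℕ}
    (hm : ∀ (i : Fin n) (S : Finset (Fin n)), i ∉ S → S.card + (m + 1) = n →
      X i ^ (m + 1) * ∏ j ∈ S, X j ∈ W)
    {i : Fin n} {S : Finset (Fin n)} (hi : i ∉ S) (hS : S.card + (m + 2) = n) :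
    X i ^ (m + 2) * ∏ j ∈ S, X j ∈ W := by
  classical
  -- Rotating the hypothesis for `insert j S` in the plane of `i` and `j`, where `x_j` is one of the
  -- variables not occurring in `x_i ^ (m + 2) * ∏ S`.
  have trade : ∀ (S : Finset (Fin n)) (j : Fin n), i ∉ S → S.card + (m + 2) = n → j ∉ S →
      j ≠ i → ((m + 1 : ℕ) : MvPolynomial (Fin n) ℝ) * (X i ^ m * X j ^ 2 * ∏ l ∈ S, X l) -
        X i ^ (m + 2) * ∏ l ∈ S, X l ∈ W := by
    intro S j hi hS hj hji
    have h := hD i j hji.symm _ (hm i (insert j S) (by simp [hi, hji.symm])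
      (by rw [Finset.card_insert_of_notMem hj]; omega))
    rw [Finset.prod_insert hj] at h
    simp only [Derivation.leibniz, Derivation.leibniz_pow, infRot_prod_X hi hj,
      infRot_X_left hji.symm, infRot_X_right hji.symm, smul_eq_mul, nsmul_eq_mul,
      Nat.add_sub_cancel] at h
    convert h using 1
    ring
  set T : Finset (Fin n) := (insert i S)ᶜ with hT
  have hTcard : T.card = m + 1 := by
    rw [hT, Finset.card_compl, Finset.card_insert_of_notMem hi, Fintype.card_fin]
    omega
  have hTmem : ∀ {j}, j ∈ T → j ∉ S ∧ j ≠ i := fun {j} hj => by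
    rw [hT, Finset.mem_compl, Finset.mem_insert, not_or] at hj
    exact ⟨hj.2, hj.1⟩
  obtain ⟨a, ha⟩ : T.Nonempty := Finset.card_pos.1 (by omega)
  obtain ⟨haS, hai⟩ := hTmem ha
  -- For `l ∈ S` the same relation holds up to the factor `3`: exchange `l` for an unused variable
  -- `a`, apply `trade` to `l`, rotate back in the plane of `a` and `l`, and reduce by `trade`
  -- for `a`.
  have trade₃ : ∀ l ∈ S,
      ((m + 1 : ℕ) : MvPolynomial (Fin n) ℝ) * (X i ^ m * X l ^ 2 * ∏ l ∈ S, X l) -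
        3 * (X i ^ (m + 2) * ∏ l ∈ S, X l) ∈ W := by
    intro l hl
    have hli : l ≠ i := fun h => hi (h ▸ hl)
    have hla : l ≠ a := fun h => haS (h ▸ hl)
    have hae : a ∉ S.erase l := fun h => haS (Finset.mem_of_mem_erase h)
    have hle : l ∉ S.erase l := Finset.notMem_erase l S
    have hcard : (S.erase l).card + 1 = S.card := Finset.card_erase_add_one hl
    have h := hD a l hla.symm _ (trade (insert a (S.erase l)) l
      (by simp [hai.symm, hi]) (by rw [Finset.card_insert_of_notMem hae]; omega)
      (by simp [hla]) hli)
    rw [Finset.prod_insert hae] at h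
    simp only [Derivation.leibniz, Derivation.leibniz_pow, infRot_prod_X hae hle, map_sub,
      infRot_X_left hla.symm, infRot_X_right hla.symm, infRot_X_of_ne hai.symm hli.symm,
      Derivation.map_natCast, smul_eq_mul, nsmul_eq_mul] at h
    have h2 := natCast_mul_mem 2 (trade S a hi hS haS hai)
    convert W.add_mem h h2 using 1
    rw [← Finset.mul_prod_erase S _ hl]
    push_cast
    ring
  -- Summing over all variables gives a positive multiple of `x_i ^ (m + 2) * ∏ S`.
  have hrad : ((m + 1 : ℕ) : MvPolynomial (Fin n) ℝ) *
      (radiusSq n * (X i ^ m * ∏ j ∈ S, X j)) ∈ W := by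
    refine natCast_mul_mem _ (hr _ ?_)
    have h1 := (isHomogeneous_X_pow (R := ℝ) i m).mul
      (IsHomogeneous.prod S (fun j => (X j : MvPolynomial (Fin n) ℝ)) (fun _ => 1)
        fun j _ => isHomogeneous_X ℝ j)
    convert h1 using 1
    simp
    omega
  have hsum : radiusSq n = (X i ^ 2 + ∑ j ∈ T, X j ^ 2 + ∑ j ∈ S, X j ^ 2 :
      MvPolynomial (Fin n) ℝ) := by
    rw [radiusSq, ← Finset.sum_add_sum_compl (insert i S), Finset.sum_insert hi]
    ring
  refine mem_of_natCast_mul_mem (k := (m + 1) + (m + 1) + 3 * S.card) (by omega) ?_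
  have htotal := W.sub_mem (W.sub_mem hrad (W.sum_mem fun j (hj : j ∈ T) =>
    trade S j hi hS (hTmem hj).1 (hTmem hj).2)) (W.sum_mem trade₃)
  convert htotal using 1
  rw [hsum]
  simp only [Finset.sum_sub_distrib, ← Finset.mul_sum, ← Finset.sum_mul, Finset.sum_const,
    nsmul_eq_mul, hTcard]
  push_cast
  ring

/-- A rotation-stable space that contains the power `x_i ^ d` contains all monomials of degree `d`:
rotations lower the exponent of `x_i` one at a time. -/
theorem monomial_mem_of_X_pow_mem (hD : ∀ a b, a ≠ b → ∀ q ∈ W, infRot a b q ∈ W) {d : ℕ}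
    (i : Fin n) (hi : X i ^ d ∈ W) (m : Fin n →₀ ℕ) (hm : m.degree = d) :
    monomial m 1 ∈ W := by
  induction h : d - m i using Nat.strong_induction_on generalizing m with
  | _ k ih =>
  by_cases hm1 : ∃ j, j ≠ i ∧ m j ≠ 0
  · obtain ⟨j, hji, hj⟩ := hm1
    obtain ⟨m, rfl⟩ : ∃ m', m = m' + Finsupp.single j 1 :=
      ⟨m - Finsupp.single j 1, (tsub_add_cancel_of_le
        (Finsupp.single_le_iff.2 (Nat.one_le_iff_ne_zero.2 hj))).symm⟩
    have hle : ∀ m' : Fin n →₀ ℕ, m'.degree = d → m' i ≤ d := fun m' h => h ▸ Finsupp.le_degree i m'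
    simp only [map_add, Finsupp.degree_single] at hm
    have hmi : m i + 1 ≤ d := by
      have := hle (m + Finsupp.single i 1) (by simpa using hm)
      simpa using this
    have h1 : monomial (m + Finsupp.single i 1) (1 : ℝ) ∈ W :=
      ih (d - (m i + 1)) (by simp [hji] at h; omega) _ (by simpa using hm) (by simp)
    -- The rotation of `x_i * m` is a positive multiple of `x_j * m`, up to a monomial with a larger
    -- exponent of `x_i`, which occurs only if `x_j` divides `m`.
    have h2 := hD i j hji.symm _ h1
    rw [infRot_apply, pderiv_monomial, pderiv_monomial, X, X, monomial_mul, monomial_mul,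
      add_tsub_cancel_right] at h2
    have h3 : monomial (Finsupp.single i 1 + (m + Finsupp.single i 1 - Finsupp.single j 1))
        (1 * (1 * (((m + Finsupp.single i 1 : Fin n →₀ ℕ) j : ℕ) : ℝ))) ∈ W := by
      by_cases hmj : m j = 0
      · simp [hmj, hji.symm]
      · obtain ⟨m, rfl⟩ : ∃ m', m = m' + Finsupp.single j 1 :=
          ⟨m - Finsupp.single j 1, (tsub_add_cancel_of_le
            (Finsupp.single_le_iff.2 (Nat.one_le_iff_ne_zero.2 hmj))).symm⟩
        have e : m + Finsupp.single j 1 + Finsupp.single i 1 - Finsupp.single j 1 =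
            m + Finsupp.single i 1 := by
          rw [add_right_comm, add_tsub_cancel_right]
        simp only [map_add, Finsupp.degree_single] at hm
        have h4 : monomial (Finsupp.single i 1 + (m + Finsupp.single i 1)) (1 : ℝ) ∈ W := by
          refine ih (d - (m i + 2)) ?_ _ ?_ ?_
          · simp [hji] at h hmi
            omega
          · simp only [map_add, Finsupp.degree_single]
            omega
          · simp
            omega
        rw [e, ← mul_one (1 * _), ← smul_eq_mul, ← smul_monomial]
        exact W.smul_mem _ h4
    have h5 := W.add_mem h2 h3
    rw [sub_add_cancel, add_comm, ← mul_one (1 * _), ← smul_eq_mul, ← smul_monomial] at h5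
    refine (W.smul_mem_iff ?_).1 h5
    simp
    positivity
  · push Not at hm1
    have : m = Finsupp.single i d := by
      have h1 : m = Finsupp.single i (m i) := by
        ext j
        by_cases hj : j = i
        · simp [hj]
        · simp [hm1 j hj, Ne.symm hj]
      have h2 : m i = d := by
        rw [h1] at hm
        simpa using hm
      rw [h1, h2]
    rw [this, ← X_pow_eq_monomial]
    exact hi

/-- A space of polynomials that is stable under infinitesimal rotations and contains `x₁ ⋯ xₙ` as
well as all multiples of `∑ i, xᵢ²` of degree `n` contains every form of degree `n`. This is where
the irreducibility of `ℋⁿ(ℝⁿ)` enters, in the form that `x₁ ⋯ xₙ` generates it. -/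
theorem homogeneous_mem_of_infRot_stable (hn : 2 ≤ n)
    (hD : ∀ a b, a ≠ b → ∀ q ∈ W, infRot a b q ∈ W) (hX : ∏ i, X i ∈ W)
    (hr : ∀ q : MvPolynomial (Fin n) ℝ, q.IsHomogeneous (n - 2) → radiusSq n * q ∈ W)
    {q : MvPolynomial (Fin n) ℝ} (hq : q.IsHomogeneous n) : q ∈ W := by
  classical
  have key : ∀ m (i : Fin n) (S : Finset (Fin n)), i ∉ S → S.card + (m + 1) = n →
      X i ^ (m + 1) * ∏ j ∈ S, X j ∈ W := by
    intro m
    induction m with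
    | zero =>
      intro i S hi hS
      have : insert i S = Finset.univ := by
        rw [← Finset.card_eq_iff_eq_univ, Finset.card_insert_of_notMem hi, Fintype.card_fin]
        exact hS
      rwa [pow_one, ← Finset.prod_insert hi, this]
    | succ m ih => exact fun i S hi hS => X_pow_succ_mul_prod_mem hD hr ih hi hS
  have hpow : X (⟨0, by omega⟩ : Fin n) ^ n ∈ W := by
    have := key (n - 1) ⟨0, by omega⟩ ∅ (by simp) (by simp; omega)
    rwa [Finset.prod_empty, mul_one, Nat.sub_add_cancel (by omega)] at this
  rw [q.as_sum]
  refine W.sum_mem fun m hm => ?_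
  have h := monomial_mem_of_X_pow_mem hD _ hpow m
    (by_contra fun h => mem_support_iff.1 hm (hq.coeff_eq_zero h))
  rw [← mul_one (coeff m q), ← smul_eq_mul, ← smul_monomial]
  exact W.smul_mem _ h

end RotationStable

/-! ### Orthogonal images of `x₁ ⋯ xₙ` -/

section Rotations

variable {n : ℕ}

/-- The rotation by the angle `t` in the coordinate plane of `a` and `b`. -/
noncomputable def planeRot (a b : Fin n) (t : ℝ) : Matrix (Fin n) (Fin n) ℝ :=
  1 + (Real.cos t - 1) • (Matrix.single a a 1 + Matrix.single b b 1) +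
    Real.sin t • (Matrix.single a b 1 - Matrix.single b a 1)

theorem planeRot_mul_transpose {a b : Fin n} (h : a ≠ b) (t : ℝ) :
    planeRot a b t * (planeRot a b t).transpose = 1 := by
  have hcs := Real.cos_sq_add_sin_sq t
  set P : Matrix (Fin n) (Fin n) ℝ := Matrix.single a a 1 + Matrix.single b b 1 with hP
  set S : Matrix (Fin n) (Fin n) ℝ := Matrix.single a b 1 - Matrix.single b a 1 with hS
  have hPP : P * P = P := by simp [hP, mul_add, add_mul, h, h.symm]
  have hSS : S * S = -P := by
    simp [hP, hS, mul_sub, sub_mul, h, h.symm]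
    abel
  have hPS : P * S = S := by simp [hP, hS, mul_sub, add_mul, h, h.symm]
  have hSP : S * P = S := by
    simp [hP, hS, mul_add, sub_mul, h, h.symm]
    abel
  have hT : (planeRot a b t).transpose = 1 + (Real.cos t - 1) • P - Real.sin t • S := by
    simp [planeRot, hP, hS]
    module
  have h0 : planeRot a b t = 1 + (Real.cos t - 1) • P + Real.sin t • S := rfl
  rw [hT, h0]
  simp only [mul_sub, mul_add, add_mul, smul_mul_assoc, mul_smul_comm, hPP, hSS, hPS, hSP,
    one_mul, mul_one]
  have h2 : (2 * (Real.cos t - 1) + (Real.cos t - 1) ^ 2 + Real.sin t ^ 2) • P = 0 := by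
    rw [show 2 * (Real.cos t - 1) + (Real.cos t - 1) ^ 2 + Real.sin t ^ 2 = 0 by linarith,
      zero_smul]
  rw [← sub_eq_zero, ← h2]
  module

theorem planeRot_zero (a b : Fin n) : planeRot a b 0 = 1 := by simp [planeRot]

/-- The derivative at `t = 0` of the rotation of a polynomial in a coordinate plane is, coefficient
by coefficient, its image under the infinitesimal rotation. -/
theorem hasDerivAt_coeff_substMatrix_planeRot {a b : Fin n} (h : a ≠ b)
    (q : MvPolynomial (Fin n) ℝ) (m : Fin n →₀ ℕ) :
    HasDerivAt (fun t => coeff m (substMatrix (planeRot a b t) q)) (coeff m (infRot a b q)) 0 := by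
  classical
  induction q using MvPolynomial.induction_on generalizing m with
  | C c => simpa [substMatrix] using hasDerivAt_const (0 : ℝ) _
  | add p q hp hq =>
    simp only [map_add, coeff_add]
    exact (hp m).add (hq m)
  | mul_X p i hp =>
    have hlin : ∀ l, HasDerivAt (fun t => coeff l (substMatrix (planeRot a b t) (X i)))
        (coeff l (infRot a b (X i))) 0 := by
      intro l
      have hentry : ∀ j, HasDerivAt (fun t => planeRot a b t i j)
          ((Matrix.single a b 1 - Matrix.single b a 1 : Matrix (Fin n) (Fin n) ℝ) i j) 0 := by
        intro j
        have h1 := ((((Real.hasDerivAt_cos 0).sub_const 1).mul_const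
          ((Matrix.single a a 1 + Matrix.single b b 1 : Matrix (Fin n) (Fin n) ℝ) i j)).const_add
          ((1 : Matrix (Fin n) (Fin n) ℝ) i j)).add ((Real.hasDerivAt_sin 0).mul_const
          ((Matrix.single a b 1 - Matrix.single b a 1 : Matrix (Fin n) (Fin n) ℝ) i j))
        simp only [Real.sin_zero, Real.cos_zero, neg_zero, zero_mul, zero_add, one_mul] at h1
        exact h1
      have hsum : infRot a b (X i) = ∑ j,
          C ((Matrix.single a b 1 - Matrix.single b a 1 : Matrix (Fin n) (Fin n) ℝ) i j) *
            (X j : MvPolynomial (Fin n) ℝ) := by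
        simp only [Matrix.sub_apply, map_sub, sub_mul, Finset.sum_sub_distrib]
        by_cases hia : i = a
        · subst hia
          simp [infRot_X_left h, Matrix.single_apply, h.symm, apply_ite C]
        · by_cases hib : i = b
          · subst hib
            simp [infRot_X_right h, Matrix.single_apply, h, apply_ite C]
          · simp [infRot_X_of_ne hia hib, Ne.symm hia, Ne.symm hib]
      rw [hsum]
      simp only [substMatrix, aeval_X, coeff_sum, coeff_C_mul]
      exact HasDerivAt.fun_sum fun j _ => (hentry j).mul_const _
    have h0 : ∀ p, substMatrix (planeRot a b 0) p = p := fun p => by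
      rw [planeRot_zero, substMatrix_one]
      rfl
    simp only [map_mul, coeff_mul]
    have hprod := HasDerivAt.fun_sum (u := Finset.HasAntidiagonal.antidiagonal m)
      fun x _ => (hp x.1).mul (hlin x.2)
    refine hprod.congr_deriv ?_
    rw [Derivation.leibniz, coeff_add, smul_eq_mul, smul_eq_mul, mul_comm (X i), coeff_mul,
      coeff_mul, ← Finset.sum_add_distrib]
    refine Finset.sum_congr rfl fun x _ => ?_
    rw [h0, h0]
    ring

theorem hasDerivAt_fischer_substMatrix_planeRot {a b : Fin n} (h : a ≠ b)
    (p q : MvPolynomial (Fin n) ℝ) :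
    HasDerivAt (fun t => fischer p (substMatrix (planeRot a b t) q))
      (fischer p (infRot a b q)) 0 := by
  simp only [fischer_eq_sum]
  exact HasDerivAt.fun_sum fun m _ =>
    ((hasDerivAt_coeff_substMatrix_planeRot h q m).const_mul _).const_mul _

/-- The polynomials all of whose orthogonal substitutions are orthogonal to `h`. -/
noncomputable def orbitAnnihilator (h : MvPolynomial (Fin n) ℝ) :
    Submodule ℝ (MvPolynomial (Fin n) ℝ) where
  carrier := {q | ∀ M : Matrix (Fin n) (Fin n) ℝ, M * M.transpose = 1 →
    fischer h (substMatrix M q) = 0}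
  add_mem' hp hq M hM := by rw [map_add, map_add, hp M hM, hq M hM, add_zero]
  zero_mem' M _ := by rw [map_zero, map_zero]
  smul_mem' c q hq M hM := by rw [map_smul, map_smul, hq M hM, smul_zero]

theorem infRot_mem_orbitAnnihilator (h : MvPolynomial (Fin n) ℝ) {a b : Fin n} (hab : a ≠ b)
    {q : MvPolynomial (Fin n) ℝ} (hq : q ∈ orbitAnnihilator h) :
    infRot a b q ∈ orbitAnnihilator h := by
  intro M hM
  have hM' : M.transpose * M = 1 := mul_eq_one_comm.1 hM
  -- `⟨h, M · q⟩ = ⟨Mᵀ · h, q⟩` turns the pairing into one to which the derivative applies.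
  have hadj : ∀ r, fischer h (substMatrix M r) = fischer (substMatrix M.transpose h) r := by
    intro r
    rw [← fischer_substMatrix (M := M.transpose) (by rwa [Matrix.transpose_transpose]),
      ← AlgHom.comp_apply, ← substMatrix_mul, hM,
      substMatrix_one, AlgHom.id_apply]
  rw [hadj]
  refine (hasDerivAt_fischer_substMatrix_planeRot hab _ q).unique ?_
  refine (hasDerivAt_const (0 : ℝ) (0 : ℝ)).congr_of_eventuallyEq (.of_forall fun t => ?_)
  change fischer _ (substMatrix (planeRot a b t) q) = 0
  rw [← hadj, ← AlgHom.comp_apply, ← substMatrix_mul]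
  refine hq _ ?_
  rw [Matrix.transpose_mul, Matrix.mul_assoc, ← Matrix.mul_assoc M, hM, Matrix.one_mul,
    planeRot_mul_transpose hab]

/-- The orthogonal images of `x₁ ⋯ xₙ` span `ℋⁿ(ℝⁿ)`: a harmonic form of degree `n` that is
orthogonal to all of them is zero. -/
theorem eq_zero_of_fischer_substMatrix_prod_X (hn : 2 ≤ n) {h : MvPolynomial (Fin n) ℝ}
    (hh : h ∈ harmonicSpace n n)
    (h0 : ∀ M : Matrix (Fin n) (Fin n) ℝ, M * M.transpose = 1 →
      fischer h (substMatrix M (∏ i, X i)) = 0) : h = 0 := by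
  have hΔ : laplacian n h = 0 := hh.2
  have hmem : h ∈ orbitAnnihilator h :=
    homogeneous_mem_of_infRot_stable hn (fun a b hab q hq => infRot_mem_orbitAnnihilator h hab hq)
      h0 (fun q _ M hM => by
        rw [map_mul, substMatrix_radiusSq (mul_eq_one_comm.1 hM), fischer_comm,
          fischer_radiusSq_mul, hΔ, map_zero]) hh.1
  have := hmem 1 (by simp)
  rw [substMatrix_one] at this
  exact eq_zero_of_fischer_self_eq_zero this

end Rotations

/-! ### The Krylov determinant -/

section Krylov

variable {n : ℕ}

/-- The matrix over `ℝ[x₁, …, xₙ]` whose columns are `x, A x, A² x, …, Aⁿ⁻¹ x`. -/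
noncomputable def krylovMatrix (A : Matrix (Fin n) (Fin n) ℝ) :
    Matrix (Fin n) (Fin n) (MvPolynomial (Fin n) ℝ) :=
  Matrix.of fun i j => ∑ k, C ((A ^ (j : ℕ)) i k) * X k

/-- The polynomial `det (x, A x, A² x, …, Aⁿ⁻¹ x)` in `x`. -/
noncomputable def krylovDet (A : Matrix (Fin n) (Fin n) ℝ) : MvPolynomial (Fin n) ℝ :=
  (krylovMatrix A).det

theorem mul_pow_conj {M : Matrix (Fin n) (Fin n) ℝ} (hM : M * M.transpose = 1)
    (A : Matrix (Fin n) (Fin n) ℝ) (k : ℕ) :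
    M * (M.transpose * A * M) ^ k = A ^ k * M := by
  have h : M * (M.transpose * A * M) = A * M := by
    rw [← Matrix.mul_assoc, ← Matrix.mul_assoc, hM, Matrix.one_mul]
  exact (show SemiconjBy M (M.transpose * A * M) A from h).pow_right k

theorem substMatrix_krylovDet {M : Matrix (Fin n) (Fin n) ℝ} (hM : M * M.transpose = 1)
    (A : Matrix (Fin n) (Fin n) ℝ) :
    substMatrix M (krylovDet A) = C M.det * krylovDet (M.transpose * A * M) := by
  have h : (krylovMatrix A).map (substMatrix M) =
      M.map C * krylovMatrix (M.transpose * A * M) := by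
    ext1 i j
    have hX : ∀ k, substMatrix M (X k) = ∑ l, C (M k l) * X l := fun k => by simp [substMatrix]
    have hC : ∀ c, substMatrix M (C c) = C c := fun c => by simp [substMatrix]
    have hl : (krylovMatrix A).map (substMatrix M) i j =
        ∑ l, C ((A ^ (j : ℕ) * M) i l) * X l := by
      simp only [krylovMatrix, Matrix.map_apply, Matrix.of_apply, map_sum, map_mul, hX, hC,
        Matrix.mul_apply, Finset.mul_sum, Finset.sum_mul]
      rw [Finset.sum_comm]
      exact Finset.sum_congr rfl fun _ _ => Finset.sum_congr rfl fun _ _ => by ring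
    rw [hl, ← mul_pow_conj hM]
    simp only [krylovMatrix, Matrix.mul_apply, Matrix.map_apply, Matrix.of_apply, map_sum, map_mul,
      Finset.mul_sum, Finset.sum_mul]
    rw [Finset.sum_comm]
    exact Finset.sum_congr rfl fun _ _ => Finset.sum_congr rfl fun _ _ => by ring
  have hdet : (M.map C).det = (C M.det : MvPolynomial (Fin n) ℝ) := (RingHom.map_det C M).symm
  rw [krylovDet, AlgHom.map_det, AlgHom.mapMatrix_apply, h, Matrix.det_mul, hdet, krylovDet]

theorem krylovDet_diagonal (v : Fin n → ℝ) :
    krylovDet (Matrix.diagonal v) = C (Matrix.vandermonde v).det * ∏ i, X i := by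
  have h : krylovMatrix (Matrix.diagonal v) = Matrix.of fun i j =>
      (X i : MvPolynomial (Fin n) ℝ) * (Matrix.vandermonde v).map C i j := by
    ext1 i j
    simp [krylovMatrix, Matrix.diagonal_pow, Matrix.diagonal_apply, Matrix.vandermonde_apply,
      apply_ite C, mul_comm]
  have hdet : ((Matrix.vandermonde v).map C).det =
    (C (Matrix.vandermonde v).det : MvPolynomial (Fin n) ℝ) := (RingHom.map_det C _).symm
  rw [krylovDet, h, Matrix.det_mul_column, hdet, mul_comm]

theorem krylovDet_smul (c : ℝ) (A : Matrix (Fin n) (Fin n) ℝ) :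
    krylovDet (c • A) = C (c ^ (n * (n - 1) / 2)) * krylovDet A := by
  have h : krylovMatrix (c • A) = Matrix.of fun i (j : Fin n) =>
      (fun k : Fin n => (C (c ^ (k : ℕ)) : MvPolynomial (Fin n) ℝ)) j * krylovMatrix A i j := by
    ext1 i j
    simp only [krylovMatrix, Matrix.of_apply, smul_pow, Matrix.smul_apply, smul_eq_mul, map_mul,
      Finset.mul_sum, mul_assoc]
  rw [krylovDet, h, Matrix.det_mul_row, ← map_prod, Finset.prod_pow_eq_pow_sum, krylovDet,
    ← Finset.sum_range_id, Finset.sum_range]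

theorem prod_X_mem_harmonicSpace : (∏ i, X i : MvPolynomial (Fin n) ℝ) ∈ harmonicSpace n n := by
  refine ⟨?_, ?_⟩
  · have := IsHomogeneous.prod Finset.univ (fun i : Fin n => (X i : MvPolynomial (Fin n) ℝ))
      (fun _ => 1) fun i _ => isHomogeneous_X ℝ i
    simpa using this
  · change laplacian n _ = 0
    rw [laplacian, LinearMap.sum_apply]
    refine Finset.sum_eq_zero fun i _ => ?_
    have h0 : pderiv i (∏ j ∈ Finset.univ.erase i, X j : MvPolynomial (Fin n) ℝ) = 0 := by
      refine Finset.prod_induction _ (fun p => pderiv i p = 0) (fun p q hp hq => ?_) (by simp)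
        fun j hj => pderiv_X_of_ne (Finset.ne_of_mem_erase hj)
      simp [hp, hq]
    rw [← Finset.mul_prod_erase _ _ (Finset.mem_univ i)]
    simp [h0]

/-- The Krylov determinant of a symmetric matrix, in terms of its eigenvalues and an orthonormal
eigenbasis. -/
theorem exists_krylovDet_eq {A : Matrix (Fin n) (Fin n) ℝ} (hA : A.IsSymm) :
    ∃ (v : Fin n → ℝ) (M : Matrix (Fin n) (Fin n) ℝ) (ε : ℝ), M * M.transpose = 1 ∧ ε ^ 2 = 1 ∧
      A.charpoly = ∏ i, (Polynomial.X - Polynomial.C (v i)) ∧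
      krylovDet A = (ε * (Matrix.vandermonde v).det) • substMatrix M (∏ i, X i) := by
  have hH : A.IsHermitian := by
    rw [Matrix.IsHermitian, Matrix.conjTranspose_eq_transpose_of_trivial]
    exact hA
  set U : Matrix (Fin n) (Fin n) ℝ := hH.eigenvectorUnitary.val
  have hUU : U * U.transpose = 1 := by
    have := Unitary.coe_mul_star_self hH.eigenvectorUnitary
    rwa [Unitary.coe_star, Matrix.star_eq_conjTranspose,
      Matrix.conjTranspose_eq_transpose_of_trivial] at this
  have hUU' : U.transpose * U = 1 := mul_eq_one_comm.1 hUU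
  have hdet : U.det * U.det = 1 := by
    simpa only [Matrix.det_mul, Matrix.det_transpose, Matrix.det_one] using
      congrArg Matrix.det hUU
  have hspec : A = U * Matrix.diagonal hH.eigenvalues * U.transpose := by
    have := hH.spectral_theorem
    rw [Unitary.conjStarAlgAut_apply, Matrix.star_eq_conjTranspose,
      Matrix.conjTranspose_eq_transpose_of_trivial] at this
    exact this
  refine ⟨hH.eigenvalues, U.transpose, U.det, by rwa [Matrix.transpose_transpose],
    by rw [pow_two, hdet], hH.charpoly_eq, ?_⟩
  have h := substMatrix_krylovDet (M := U.transpose) (by rwa [Matrix.transpose_transpose])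
    (Matrix.diagonal hH.eigenvalues)
  rw [Matrix.transpose_transpose, ← hspec, krylovDet_diagonal, map_mul, Matrix.det_transpose] at h
  have hC : substMatrix U.transpose (C (Matrix.vandermonde hH.eigenvalues).det) =
      C (Matrix.vandermonde hH.eigenvalues).det := by simp [substMatrix]
  rw [hC] at h
  rw [smul_eq_C_mul, map_mul, mul_assoc, h, ← mul_assoc, ← map_mul, hdet, map_one, one_mul]

theorem krylovDet_mem_harmonicSpace {A : Matrix (Fin n) (Fin n) ℝ} (hA : A.IsSymm) :
    krylovDet A ∈ harmonicSpace n n := by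
  obtain ⟨v, M, ε, hM, -, -, h⟩ := exists_krylovDet_eq hA
  rw [h]
  exact Submodule.smul_mem _ _ (substMatrix_mem M hM prod_X_mem_harmonicSpace)

/-- The discriminant is the squared Fischer norm of the Krylov determinant. -/
theorem fischer_krylovDet_self (hn : 0 < n) {A : Matrix (Fin n) (Fin n) ℝ} (hA : A.IsSymm) :
    fischer (krylovDet A) (krylovDet A) = A.discr := by
  obtain ⟨v, M, ε, hM, hε, hc, h⟩ := exists_krylovDet_eq hA
  rw [h, Matrix.discr, hc, discr_prod_X_sub_C hn, map_smul, map_smul, LinearMap.smul_apply,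
    fischer_substMatrix hM, fischer_prod_X]
  simp only [smul_eq_mul]
  linear_combination (Matrix.vandermonde v).det ^ 2 * hε

theorem krylovDet_eq_zero_of_isDegenerate {A : Matrix (Fin n) (Fin n) ℝ} (hA : A.IsSymm)
    (hd : IsDegenerate A) : krylovDet A = 0 := by
  obtain ⟨v, M, ε, -, -, hc, h⟩ := exists_krylovDet_eq hA
  obtain ⟨μ, hμ⟩ := hd
  suffices (Matrix.vandermonde v).det = 0 by rw [h, this, mul_zero, zero_smul]
  by_contra hV
  have hinj : Function.Injective v := Matrix.det_vandermonde_ne_zero_iff.1 hV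
  rw [hc, ← Polynomial.count_roots, Polynomial.roots_prod _ _
    (Finset.prod_ne_zero_iff.2 fun i _ => Polynomial.X_sub_C_ne_zero _)] at hμ
  simp only [Polynomial.roots_X_sub_C, Multiset.bind_singleton] at hμ
  have := Multiset.nodup_iff_count_le_one.1 (Finset.univ.nodup.map hinj) μ
  omega

end Krylov

/-! ### Polynomial dependence of the Krylov determinant on the matrix -/

section PolynomialDependence

variable {n : ℕ} (V : Submodule ℝ (Matrix (Fin n) (Fin n) ℝ))

/-- The functions from `V` to `ℝ[x₁, …, xₙ]` all of whose coefficients are polynomial functions. -/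
def polyFamily : Subalgebra ℝ (V → MvPolynomial (Fin n) ℝ) where
  carrier := {F | ∀ m, (fun v => coeff m (F v)) ∈ PolyFun V}
  mul_mem' {F G} hF hG m := by
    simp only [Pi.mul_apply, coeff_mul]
    have h : (fun v => ∑ x ∈ Finset.HasAntidiagonal.antidiagonal m,
        coeff x.1 (F v) * coeff x.2 (G v)) = ∑ x ∈ Finset.HasAntidiagonal.antidiagonal m,
        (fun v => coeff x.1 (F v)) * (fun v => coeff x.2 (G v)) := by
      ext v
      simp
    rw [h]
    exact Subalgebra.sum_mem _ fun x _ => Subalgebra.mul_mem _ (hF _) (hG _)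
  add_mem' {F G} hF hG m := by
    simp only [Pi.add_apply, coeff_add]
    exact Subalgebra.add_mem _ (hF m) (hG m)
  algebraMap_mem' r m := by
    exact Subalgebra.algebraMap_mem (PolyFun V)
      (coeff m (algebraMap ℝ (MvPolynomial (Fin n) ℝ) r))

theorem pow_apply_mem_polyFun (k : ℕ) (i j : Fin n) :
    (fun A : V => ((A : Matrix (Fin n) (Fin n) ℝ) ^ k) i j) ∈ PolyFun V := by
  induction k generalizing j with
  | zero =>
    simp only [pow_zero]
    exact Subalgebra.algebraMap_mem (PolyFun V) ((1 : Matrix (Fin n) (Fin n) ℝ) i j)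
  | succ k ih =>
    have h : (fun A : V => ((A : Matrix (Fin n) (Fin n) ℝ) ^ (k + 1)) i j) = ∑ l,
        (fun A : V => ((A : Matrix (Fin n) (Fin n) ℝ) ^ k) i l) *
          (fun A : V => (A : Matrix (Fin n) (Fin n) ℝ) l j) := by
      ext A
      simp [pow_succ, Matrix.mul_apply]
    rw [h]
    exact Subalgebra.sum_mem _ fun l _ => Subalgebra.mul_mem _ (ih l) <|
      Algebra.subset_adjoin ⟨(Matrix.entryLinearMap ℝ ℝ l j).comp V.subtype, rfl⟩

theorem krylovDet_mem_polyFamily :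
    (fun A : V => krylovDet (A : Matrix (Fin n) (Fin n) ℝ)) ∈ polyFamily V := by
  have hentry : ∀ i j, (fun A : V => krylovMatrix (A : Matrix (Fin n) (Fin n) ℝ) i j) ∈
      polyFamily V := by
    intro i j m
    have h : (fun A : V => coeff m (krylovMatrix (A : Matrix (Fin n) (Fin n) ℝ) i j)) =
        ∑ k, coeff m (X k : MvPolynomial (Fin n) ℝ) •
          fun A : V => ((A : Matrix (Fin n) (Fin n) ℝ) ^ (j : ℕ)) i k := by
      ext A
      simp only [krylovMatrix, Matrix.of_apply, coeff_sum, coeff_C_mul, Finset.sum_apply,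
        Pi.smul_apply, smul_eq_mul]
      exact Finset.sum_congr rfl fun _ _ => mul_comm _ _
    change (fun A : V => coeff m (krylovMatrix (A : Matrix (Fin n) (Fin n) ℝ) i j)) ∈ _
    rw [h]
    exact Subalgebra.sum_mem _ fun k _ => Subalgebra.smul_mem _ (pow_apply_mem_polyFun V _ i k) _
  have h : (fun A : V => krylovDet (A : Matrix (Fin n) (Fin n) ℝ)) =
      ∑ τ : Equiv.Perm (Fin n), ((Equiv.Perm.sign τ : ℤ) : V → MvPolynomial (Fin n) ℝ) *
        ∏ i, fun A : V => krylovMatrix (A : Matrix (Fin n) (Fin n) ℝ) (τ i) i := by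
    ext1 A
    simp [krylovDet, Matrix.det_apply']
  rw [h]
  exact Subalgebra.sum_mem _ fun τ _ => Subalgebra.mul_mem _ (intCast_mem _ _)
    (Subalgebra.prod_mem _ fun i _ => hentry _ _)

theorem fischer_krylovDet_mem_polyFun (p : MvPolynomial (Fin n) ℝ) :
    (fun A : V => fischer p (krylovDet (A : Matrix (Fin n) (Fin n) ℝ))) ∈ PolyFun V := by
  have h : (fun A : V => fischer p (krylovDet (A : Matrix (Fin n) (Fin n) ℝ))) =
      ∑ m ∈ p.support, (expWeight m * coeff m p) •
        fun A : V => coeff m (krylovDet (A : Matrix (Fin n) (Fin n) ℝ)) := by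
    ext A
    simp [fischer_eq_sum, mul_assoc]
  rw [h]
  exact Subalgebra.sum_mem _ fun m _ => Subalgebra.smul_mem _ (krylovDet_mem_polyFamily V m) _

/-- The linear map sending `p` to the polynomial function
`A ↦ ⟨p, det (x, A x, …, Aⁿ⁻¹ x)⟩` on `V`. -/
noncomputable def krylovPairing : MvPolynomial (Fin n) ℝ →ₗ[ℝ] PolyFun V where
  toFun p := ⟨fun A => fischer p (krylovDet (A : Matrix (Fin n) (Fin n) ℝ)),
    fischer_krylovDet_mem_polyFun V p⟩
  map_add' p q := Subtype.ext (by ext A; simp)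
  map_smul' c p := Subtype.ext (by ext A; simp)

theorem krylovPairing_apply (p : MvPolynomial (Fin n) ℝ) (A : V) :
    (krylovPairing V p : V → ℝ) A = fischer p (krylovDet (A : Matrix (Fin n) (Fin n) ℝ)) := rfl

end PolynomialDependence

/-! ### The embedding of `ℋⁿ(ℝⁿ)` into the vanishing ideal -/

section Equivariance

variable {n : ℕ}

theorem coordRep_krylovPairing (g : SO n) (p : MvPolynomial (Fin n) ℝ) :
    coordRep (conjRep n) g (krylovPairing (SymMat₀ n) p) =
      krylovPairing (SymMat₀ n) (substRep n g p) := by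
  refine Subtype.ext (funext fun A => ?_)
  set N : Matrix (Fin n) (Fin n) ℝ := ((g⁻¹ : SO n) : Matrix (Fin n) (Fin n) ℝ) with hN
  have h1 : N * N.transpose = 1 := SO.mul_transpose g⁻¹
  have h2 : N.transpose * N = 1 := SO.transpose_mul g⁻¹
  have hdet : N.det = 1 := (Matrix.mem_specialOrthogonalGroup_iff.1 (g⁻¹ : SO n).2).2
  change fischer p (krylovDet (N * A * N.transpose)) =
    fischer (substMatrix N p) (krylovDet (A : Matrix (Fin n) (Fin n) ℝ))
  rw [← fischer_substMatrix (M := N.transpose) (by rwa [Matrix.transpose_transpose])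
      (substMatrix N p), substMatrix_krylovDet (by rwa [Matrix.transpose_transpose]),
    Matrix.det_transpose, hdet, map_one, one_mul, Matrix.transpose_transpose,
    ← AlgHom.comp_apply, ← substMatrix_mul, h1, substMatrix_one, AlgHom.id_apply]

/-- The pairing with Krylov determinants is faithful on `ℋⁿ(ℝⁿ)`. -/
theorem krylovPairing_injOn (hn : 2 ≤ n) {p : MvPolynomial (Fin n) ℝ}
    (hp : p ∈ harmonicSpace n n) (h : krylovPairing (SymMat₀ n) p = 0) : p = 0 := by
  refine eq_zero_of_fischer_substMatrix_prod_X hn hp fun M hM => ?_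
  -- Distinct eigenvalues with sum zero: the numbers `0, …, n - 1` centred at their mean.
  set v : Fin n → ℝ := fun i => (i : ℕ) - ((n : ℝ) - 1) / 2 with hv
  have hinj : Function.Injective v := fun i j hij => by
    simp only [hv, sub_left_inj, Nat.cast_inj] at hij
    exact Fin.ext hij
  have hV : (Matrix.vandermonde v).det ≠ 0 := Matrix.det_vandermonde_ne_zero_iff.2 hinj
  have hsum : ∑ i, v i = 0 := by
    simp only [hv, Finset.sum_sub_distrib, Finset.sum_const, Finset.card_univ, Fintype.card_fin,
      nsmul_eq_mul]
    rw [Fin.sum_univ_eq_sum_range (fun i : ℕ => (i : ℝ)) n]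
    have h2 : (∑ i ∈ Finset.range n, (i : ℝ)) * 2 = n * ((n : ℝ) - 1) := by
      have := Finset.sum_range_id_mul_two n
      rw [← Nat.cast_pred (by omega), ← Nat.cast_mul, ← this]
      push_cast
      rfl
    linarith
  have hmem : M.transpose * Matrix.diagonal v * M ∈ SymMat₀ n := by
    refine ⟨?_, ?_⟩
    · change (M.transpose * Matrix.diagonal v * M).transpose = _
      simp [Matrix.transpose_mul, Matrix.mul_assoc]
    · change (M.transpose * Matrix.diagonal v * M).trace = 0
      rw [Matrix.mul_assoc, Matrix.trace_mul_comm, Matrix.mul_assoc, hM, Matrix.mul_one,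
        Matrix.trace_diagonal, hsum]
  have h0 : fischer p (krylovDet (M.transpose * Matrix.diagonal v * M)) = 0 :=
    congrFun (congrArg Subtype.val h) ⟨_, hmem⟩
  have h1 := congrArg (fischer p) (substMatrix_krylovDet hM (Matrix.diagonal v))
  have hC : substMatrix M (C (Matrix.vandermonde v).det) =
    C (Matrix.vandermonde v).det := by simp [substMatrix]
  rw [krylovDet_diagonal, map_mul, hC, ← smul_eq_C_mul, ← smul_eq_C_mul, map_smul, map_smul, h0,
    smul_zero] at h1
  exact (smul_eq_zero.1 h1).resolve_left hV

theorem krylovPairing_mem_vanishingIdealPart (p : MvPolynomial (Fin n) ℝ) :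
    krylovPairing (SymMat₀ n) p ∈ vanishingIdealPart (degenerateSet n) (n * (n - 1) / 2) := by
  refine ⟨fun A hA => ?_, fun c A => ?_⟩
  · rw [krylovPairing_apply, krylovDet_eq_zero_of_isDegenerate A.2.1 hA, map_zero]
  · rw [krylovPairing_apply, krylovPairing_apply, Submodule.coe_smul, krylovDet_smul,
      ← smul_eq_C_mul, map_smul, smul_eq_mul]

end Equivariance

/-! ### The dimension of `ℋⁿ(ℝⁿ)` and sums of squares -/

section Dimension

variable {n : ℕ}

theorem mem_finsuppAntidiag_univ_iff {d : ℕ} {m : Fin n →₀ ℕ} :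
    m ∈ (Finset.univ : Finset (Fin n)).finsuppAntidiag d ↔ m.degree = d := by
  simp [Finset.mem_finsuppAntidiag, Finsupp.degree_eq_sum]

/-- The coefficients of a form of degree `d`, scaled by the Fischer norms of the monomials. -/
noncomputable def coeffMap (n d : ℕ) : homogeneousSubmodule (Fin n) ℝ d →ₗ[ℝ]
    EuclideanSpace ℝ ((Finset.univ : Finset (Fin n)).finsuppAntidiag d) where
  toFun p := WithLp.toLp 2 fun m => √(expWeight m.1) * coeff m.1 p.1
  map_add' p q := by
    ext m
    simp [mul_add]
  map_smul' c p := by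
    ext m
    simp [mul_left_comm]

theorem coeffMap_apply {d : ℕ} (p : homogeneousSubmodule (Fin n) ℝ d)
    (m : (Finset.univ : Finset (Fin n)).finsuppAntidiag d) :
    coeffMap n d p m = √(expWeight m.1) * coeff m.1 p.1 := rfl

theorem coeffMap_bijective (n d : ℕ) : Function.Bijective (coeffMap n d) := by
  refine ⟨?_, fun f => ?_⟩
  · rw [← LinearMap.ker_eq_bot, LinearMap.ker_eq_bot']
    intro p hp
    ext m
    by_cases hm : m.degree = d
    · have h := coeffMap_apply p ⟨m, mem_finsuppAntidiag_univ_iff.2 hm⟩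
      rw [hp] at h
      exact (mul_eq_zero.1 h.symm).resolve_left (Real.sqrt_pos.2 (expWeight_pos m)).ne'
    · exact IsHomogeneous.coeff_eq_zero p.2 hm
  · refine ⟨⟨∑ m : (Finset.univ : Finset (Fin n)).finsuppAntidiag d,
      monomial m.1 (f m / √(expWeight m.1)), Submodule.sum_mem _ fun m _ =>
        isHomogeneous_monomial _ (mem_finsuppAntidiag_univ_iff.1 m.2)⟩, ?_⟩
    ext m
    have h : ∑ l : (Finset.univ : Finset (Fin n)).finsuppAntidiag d,
        coeff m.1 (monomial l.1 (f l / √(expWeight l.1))) = f m / √(expWeight m.1) := by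
      rw [Finset.sum_eq_single m]
      · rw [coeff_monomial, if_pos rfl]
      · intro l _ hl
        rw [coeff_monomial, if_neg fun h => hl (Subtype.ext h)]
      · simp
    rw [coeffMap_apply, coeff_sum, h, mul_div_cancel₀ _ (Real.sqrt_pos.2 (expWeight_pos m.1)).ne']

/-- The identification of the forms of degree `d`, with the Fischer inner product, with a Euclidean
space. -/
noncomputable def coeffEquiv (n d : ℕ) : homogeneousSubmodule (Fin n) ℝ d ≃ₗ[ℝ]
    EuclideanSpace ℝ ((Finset.univ : Finset (Fin n)).finsuppAntidiag d) :=
  LinearEquiv.ofBijective (coeffMap n d) (coeffMap_bijective n d)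

theorem inner_coeffMap {d : ℕ} (p q : homogeneousSubmodule (Fin n) ℝ d) :
    inner ℝ (coeffMap n d p) (coeffMap n d q) = fischer p.1 q.1 := by
  have hsub : p.1.support ⊆ (Finset.univ : Finset (Fin n)).finsuppAntidiag d := fun m hm =>
    mem_finsuppAntidiag_univ_iff.2
      (by_contra fun h => mem_support_iff.1 hm (IsHomogeneous.coeff_eq_zero p.2 h))
  calc inner ℝ (coeffMap n d p) (coeffMap n d q)
      = ∑ m : (Finset.univ : Finset (Fin n)).finsuppAntidiag d,
          expWeight m.1 * (coeff m.1 p.1 * coeff m.1 q.1) := by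
        rw [PiLp.inner_apply]
        refine Finset.sum_congr rfl fun m _ => ?_
        rw [coeffMap_apply, coeffMap_apply, RCLike.inner_apply, conj_trivial]
        linear_combination (coeff m.1 q.1 * coeff m.1 p.1) *
          Real.mul_self_sqrt (expWeight_pos m.1).le
    _ = ∑ m ∈ (Finset.univ : Finset (Fin n)).finsuppAntidiag d,
          expWeight m * (coeff m p.1 * coeff m q.1) :=
        Finset.sum_coe_sort _ fun m => expWeight m * (coeff m p.1 * coeff m q.1)
    _ = fischer p.1 q.1 := by
        rw [fischer_eq_sum]
        refine (Finset.sum_subset hsub fun m _ hm => ?_).symm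
        rw [notMem_support_iff.1 hm, zero_mul, mul_zero]

instance finiteDimensional_homogeneousSubmodule (d : ℕ) :
    FiniteDimensional ℝ (homogeneousSubmodule (Fin n) ℝ d) :=
  (coeffEquiv n d).symm.finiteDimensional

instance finiteDimensional_harmonicSpace (d : ℕ) : FiniteDimensional ℝ (harmonicSpace d n) :=
  Submodule.finiteDimensional_of_le (inf_le_left : _ ≤ homogeneousSubmodule (Fin n) ℝ d)

theorem finrank_homogeneousSubmodule (d : ℕ) :
    Module.finrank ℝ (homogeneousSubmodule (Fin n) ℝ d) = (n + d - 1).choose d := by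
  rw [(coeffEquiv n d).finrank_eq, finrank_euclideanSpace, Fintype.card_coe,
    Finset.card_finsuppAntidiag_nat_eq_choose, Finset.card_univ, Fintype.card_fin]

/-- Harmonic forms meet the multiples of `∑ i, xᵢ²` trivially, as the two are orthogonal. -/
theorem finrank_harmonicSpace_add_le (hn : 0 < n) (d : ℕ) :
    Module.finrank ℝ (harmonicSpace (d + 2) n) +
      Module.finrank ℝ (homogeneousSubmodule (Fin n) ℝ d) ≤
      Module.finrank ℝ (homogeneousSubmodule (Fin n) ℝ (d + 2)) := by
  have hrad : radiusSq n ≠ 0 := fun h => by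
    have := congrArg (eval fun _ => (1 : ℝ)) h
    simp [radiusSq] at this
    omega
  have hmul : ∀ q ∈ homogeneousSubmodule (Fin n) ℝ d,
      radiusSq n * q ∈ homogeneousSubmodule (Fin n) ℝ (d + 2) := fun q hq => by
    rw [add_comm]
    exact (IsHomogeneous.sum _ _ _ fun i _ => isHomogeneous_X_pow i 2).mul hq
  let F : (harmonicSpace (d + 2) n × homogeneousSubmodule (Fin n) ℝ d) →ₗ[ℝ]
      homogeneousSubmodule (Fin n) ℝ (d + 2) :=
    LinearMap.codRestrict _ ((harmonicSpace (d + 2) n).subtype.coprod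
      (LinearMap.mulLeft ℝ (radiusSq n) ∘ₗ (homogeneousSubmodule (Fin n) ℝ d).subtype))
      fun x => by
        refine Submodule.add_mem _ x.1.2.1 ?_
        exact hmul _ x.2.2
  have hF : Function.Injective F := by
    rw [← LinearMap.ker_eq_bot, LinearMap.ker_eq_bot']
    rintro ⟨h, q⟩ hq
    have h0 : h.1 + radiusSq n * q.1 = 0 := congrArg Subtype.val hq
    have hΔ : laplacian n h.1 = 0 := h.2.2
    have hh : h.1 = 0 := by
      refine eq_zero_of_fischer_self_eq_zero ?_
      nth_rewrite 1 [eq_neg_of_add_eq_zero_left h0]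
      rw [map_neg, LinearMap.neg_apply, fischer_radiusSq_mul, hΔ, map_zero, neg_zero]
    rw [hh, zero_add] at h0
    exact Prod.ext (Subtype.ext hh)
      (Subtype.ext ((mul_eq_zero.1 h0).resolve_left hrad))
  rw [← Module.finrank_prod]
  exact LinearMap.finrank_le_finrank_of_injective hF

/-- By the preceding bound `dim ℋⁿ(ℝⁿ)` is at most the number of monomials of degree `n` minus the
number of those of degree `n - 2`. -/
theorem finrank_harmonicSpace_le (hn : 2 ≤ n) :
    Module.finrank ℝ (harmonicSpace n n) ≤
      (2 * n - 1).choose (n - 1) - (2 * n - 3).choose (n - 1) := by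
  obtain ⟨d, rfl⟩ : ∃ d, n = d + 2 := ⟨n - 2, by omega⟩
  have h := finrank_harmonicSpace_add_le (n := d + 2) (by omega) d
  rw [finrank_homogeneousSubmodule, finrank_homogeneousSubmodule] at h
  have h1 : (2 * (d + 2) - 1).choose (d + 2 - 1) = (d + 2 + (d + 2) - 1).choose (d + 2) := by
    rw [show d + 2 + (d + 2) - 1 = 2 * (d + 2) - 1 by omega]
    exact Nat.choose_symm_of_eq_add (by omega)
  have h2 : (2 * (d + 2) - 3).choose (d + 2 - 1) = (d + 2 + d - 1).choose d := by
    rw [show d + 2 + d - 1 = 2 * (d + 2) - 3 by omega]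
    exact Nat.choose_symm_of_eq_add (by omega)
  omega

/-- Parseval's identity for the Fischer inner product on harmonic forms of degree `n`. -/
theorem exists_harmonic_parseval (hn : 2 ≤ n) :
    ∃ h : Fin ((2 * n - 1).choose (n - 1) - (2 * n - 3).choose (n - 1)) →
        MvPolynomial (Fin n) ℝ,
      ∀ p ∈ harmonicSpace n n, fischer p p = ∑ i, fischer (h i) p ^ 2 := by
  let T : harmonicSpace n n →ₗ[ℝ]
      EuclideanSpace ℝ ((Finset.univ : Finset (Fin n)).finsuppAntidiag n) :=
    coeffMap n n ∘ₗ Submodule.inclusion inf_le_left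
  have hT : ∀ p q, inner ℝ (T p) (T q) = fischer p.1 q.1 := fun p q => inner_coeffMap _ _
  let b := stdOrthonormalBasis ℝ (LinearMap.range T)
  have hb : ∀ i, ∃ h, T h = b i := fun i => (b i).2
  choose h hh using hb
  obtain ⟨r, hr⟩ := Nat.exists_eq_add_of_le
    ((LinearMap.finrank_range_le T).trans (finrank_harmonicSpace_le hn))
  rw [hr]
  -- The orthonormal basis is padded with zeros up to the required length.
  refine ⟨Fin.append (fun i => (h i).1) fun _ => 0, fun p hp => ?_⟩
  have hsum := b.sum_sq_norm_inner_right ⟨T ⟨p, hp⟩, LinearMap.mem_range_self T _⟩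
  simp only [Fin.sum_univ_add, Fin.append_left, Fin.append_right, map_zero, LinearMap.zero_apply,
    zero_pow two_ne_zero, Finset.sum_const_zero, add_zero]
  calc fischer p p = ‖T ⟨p, hp⟩‖ ^ 2 := by rw [← real_inner_self_eq_norm_sq, hT]
    _ = ∑ i, ‖inner ℝ (b i) ⟨T ⟨p, hp⟩, LinearMap.mem_range_self T _⟩‖ ^ 2 := hsum.symm
    _ = ∑ i, fischer (h i).1 p ^ 2 := by
      refine Finset.sum_congr rfl fun i _ => ?_
      rw [Submodule.coe_inner, ← hh, hT, Real.norm_eq_abs, sq_abs]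

end Dimension

/-! ### The submodule and the sum of squares -/

section Conclusion

theorem exists_subrepresentation_equiv_sphericalHarmonics {n : ℕ} (hn : 2 ≤ n) :
    ∃ W : Subrepresentation (coordRep (conjRep n)),
      W.toSubmodule ≤ vanishingIdealPart (degenerateSet n) (n * (n - 1) / 2) ∧
      Nonempty (W.toRepresentation.Equiv (sphericalHarmonics n n).toRepresentation) := by
  let Φ : harmonicSpace n n →ₗ[ℝ] PolyFun (SymMat₀ n) :=
    krylovPairing (SymMat₀ n) ∘ₗ (harmonicSpace n n).subtype
  have hΦ : Function.Injective Φ := by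
    rw [← LinearMap.ker_eq_bot, LinearMap.ker_eq_bot']
    exact fun p hp => Subtype.ext (krylovPairing_injOn hn p.2 hp)
  let W : Subrepresentation (coordRep (conjRep n)) :=
    { toSubmodule := LinearMap.range Φ
      apply_mem_toSubmodule := by
        rintro g _ ⟨p, rfl⟩
        exact ⟨⟨substRep n g p, (sphericalHarmonics n n).apply_mem_toSubmodule g p.2⟩,
          (coordRep_krylovPairing g p.1).symm⟩ }
  refine ⟨W, ?_, ⟨Representation.Equiv.symm (Representation.Equiv.mk
    (LinearEquiv.ofInjective Φ hΦ) fun g => ?_)⟩⟩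
  · rintro _ ⟨p, rfl⟩
    exact krylovPairing_mem_vanishingIdealPart p.1
  · exact LinearMap.ext fun p => Subtype.ext (coordRep_krylovPairing g p.1).symm

theorem exists_discr_eq_sum_sq {n : ℕ} (hn : 2 ≤ n) :
    ∃ f : Fin ((2 * n - 1).choose (n - 1) - (2 * n - 3).choose (n - 1)) → PolyFun (SymMat n),
      ∀ A : SymMat n,
        (A : Matrix (Fin n) (Fin n) ℝ).discr = ∑ i, (f i : SymMat n → ℝ) A ^ 2 := by
  obtain ⟨h, hh⟩ := exists_harmonic_parseval hn
  refine ⟨fun i => krylovPairing (SymMat n) (h i), fun A => ?_⟩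
  simp only [krylovPairing_apply]
  rw [← fischer_krylovDet_self (by omega) A.2, hh _ (krylovDet_mem_harmonicSpace A.2)]

end Conclusion

end SymDisc

theorem theorem1 (n : ℕ) (hn : 2 ≤ n) :
    (∃ W : Subrepresentation (SymDisc.coordRep (SymDisc.conjRep n)),
      W.toSubmodule ≤
        SymDisc.vanishingIdealPart (SymDisc.degenerateSet n) (n * (n - 1) / 2) ∧
      Nonempty (W.toRepresentation.Equiv
        (SymDisc.sphericalHarmonics n n).toRepresentation)) ∧
    (∃ f : Fin ((2 * n - 1).choose (n - 1) - (2 * n - 3).choose (n - 1)) →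
        SymDisc.PolyFun (SymDisc.SymMat n),
      ∀ A : SymDisc.SymMat n,
        (A : Matrix (Fin n) (Fin n) ℝ).discr = ∑ i, (f i : SymDisc.SymMat n → ℝ) A ^ 2) :=
  ⟨SymDisc.exists_subrepresentation_equiv_sphericalHarmonics hn, SymDisc.exists_discr_eq_sum_sq hn⟩
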